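/- For $n\ge 0$ let $(a;q)_n=\prod_{j=1}^{n}(1-aq^{j-1})$ and $(a;q)_\infty=\lim_{n\to\infty}(a;q)_n$. For integers $n_1,n_{21},n_{22}\ge 0$ put $$T_{n_1,n_{21},n_{22}}(q)=\frac{q^{6n_{21}^2-n_{21}+6n_{22}^2+n_{22}+2n_1^2-n_1+12n_{21}n_{22}+6(n_{21}+n_{22})n_1}}{(q;q)_{n_1}(q^6;q^6)_{n_{21}}(q^6;q^6)_{n_{22}}}.$$ Then $$\sum_{n_1,n_{21},n_{22}\ge 0}T_{n_1,n_{21},n_{22}}(q)=\frac{1}{(q;q^6)_\infty(q^5;q^6)_\infty},$$ both as an identity of formal power series in $q$ with integer coefficients and as an identity of (unconditionally) convergent series for every complex $q$ with $|q|<1$; the infinite products exist, and they are invertible, respectively nonzero. Every $T_{n_1,n_{21},n_{22}}(q)$ is a power series with nonnegative coefficients. Moreover, as a formal power series, the triple sum equals $\sum_{n\ge 0}s(n)q^n$, where $s(n)$ is the number of partitions of $n$ into positive parts that are pairwise at least $3$ apart and contain no two consecutive multiples of $3$ (so that multiples of $3$ are at least $6$ apart). -/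

import Mathlib

open Filter Topology
open scoped PowerSeries PowerSeries.WithPiTopology

namespace SchurSeries

/-- The finite q-Pochhammer symbol `(a; q)_n = ∏_{j = 1}^{n} (1 - a q^{j-1})`. -/
def qPoch {R : Type*} [CommRing R] (a q : R) (n : ℕ) : R :=
  ∏ j ∈ Finset.range n, (1 - a * q ^ j)

/-- The infinite q-Pochhammer symbol `(a; q)_∞ = lim_{n → ∞} (a; q)_n`. -/
noncomputable def qPochInf {R : Type*} [CommRing R] [TopologicalSpace R] (a q : R) : R :=
  limUnder atTop (qPoch a q)

/-- The exponent `6 n₂₁² - n₂₁ + 6 n₂₂² + n₂₂ + 2 n₁² - n₁ + 12 n₂₁ n₂₂ + 6 (n₂₁ + n₂₂) n₁`.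
The two subtractions of natural numbers never truncate, see `cast_expo`. -/
def expo (n₁ n₂₁ n₂₂ : ℕ) : ℕ :=
  (6 * n₂₁ ^ 2 - n₂₁) + (6 * n₂₂ ^ 2 + n₂₂) + (2 * n₁ ^ 2 - n₁)
    + 12 * n₂₁ * n₂₂ + 6 * (n₂₁ + n₂₂) * n₁

theorem cast_expo (n₁ n₂₁ n₂₂ : ℕ) :
    (expo n₁ n₂₁ n₂₂ : ℤ) =
      6 * (n₂₁ : ℤ) ^ 2 - n₂₁ + 6 * (n₂₂ : ℤ) ^ 2 + n₂₂ + 2 * (n₁ : ℤ) ^ 2 - n₁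
        + 12 * n₂₁ * n₂₂ + 6 * ((n₂₁ : ℤ) + n₂₂) * n₁ := by
  have h1 : n₂₁ ≤ 6 * n₂₁ ^ 2 := by nlinarith [Nat.le_self_pow two_ne_zero n₂₁]
  have h2 : n₁ ≤ 2 * n₁ ^ 2 := by nlinarith [Nat.le_self_pow two_ne_zero n₁]
  unfold expo
  push_cast [Nat.cast_sub h1, Nat.cast_sub h2]
  ring

/-- The denominator `(q; q)_{n₁} (q⁶; q⁶)_{n₂₁} (q⁶; q⁶)_{n₂₂}`. -/
def den {R : Type*} [CommRing R] (q : R) (n₁ n₂₁ n₂₂ : ℕ) : R :=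
  qPoch q q n₁ * qPoch (q ^ 6) (q ^ 6) n₂₁ * qPoch (q ^ 6) (q ^ 6) n₂₂

theorem isUnit_den (n₁ n₂₁ n₂₂ : ℕ) : IsUnit (den (PowerSeries.X : ℤ⟦X⟧) n₁ n₂₁ n₂₂) := by
  simp [PowerSeries.isUnit_iff_constantCoeff, den, qPoch]

theorem den_ne_zero {q : ℂ} (hq : ‖q‖ < 1) (n₁ n₂₁ n₂₂ : ℕ) : den q n₁ n₂₁ n₂₂ ≠ 0 := by
  have h : ∀ k : ℕ, k ≠ 0 → 1 - q ^ k ≠ 0 := fun k hk h0 => by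
    have h1 : ‖q ^ k‖ < 1 := by
      rw [norm_pow]
      exact pow_lt_one₀ (norm_nonneg q) hq hk
    rw [← sub_eq_zero.mp h0, norm_one] at h1
    exact lt_irrefl _ h1
  have h6 : ∀ n, qPoch (q ^ 6) (q ^ 6) n ≠ 0 := fun n =>
    Finset.prod_ne_zero_iff.mpr fun j _ => by
      rw [← pow_succ', ← pow_mul]
      exact h _ (by omega)
  have h1 : qPoch q q n₁ ≠ 0 :=
    Finset.prod_ne_zero_iff.mpr fun j _ => by
      rw [← pow_succ']
      exact h _ (by omega)
  exact mul_ne_zero (mul_ne_zero h1 (h6 _)) (h6 _)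

/-- The general term of the triple series, as a formal power series in the variable `q = X`.
The denominator is invertible, see `isUnit_den`. The index is `(n₁, n₂₁, n₂₂)`. -/
noncomputable def formalTerm (n : ℕ × ℕ × ℕ) : ℤ⟦X⟧ :=
  PowerSeries.X ^ expo n.1 n.2.1 n.2.2 * Ring.inverse (den PowerSeries.X n.1 n.2.1 n.2.2)

/-- The general term of the triple series at a complex number `q`.
The denominator does not vanish for `‖q‖ < 1`, see `den_ne_zero`. -/
noncomputable def complexTerm (q : ℂ) (n : ℕ × ℕ × ℕ) : ℂ :=
  q ^ expo n.1 n.2.1 n.2.2 / den q n.1 n.2.1 n.2.2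

/-- A partition (into positive parts) satisfies Schur's condition if its parts are pairwise at
least 3 apart and its multiples of 3 are pairwise at least 6 apart (that is, it contains no two
consecutive multiples of 3). -/
def IsSchur {n : ℕ} (p : n.Partition) : Prop :=
  p.parts.Nodup ∧
    ∀ a ∈ p.parts, ∀ b ∈ p.parts, a < b → a + 3 ≤ b ∧ (3 ∣ a → 3 ∣ b → a + 6 ≤ b)

/-- `s n` is the number of partitions of `n` that satisfy Schur's condition. -/
noncomputable def s (n : ℕ) : ℕ :=
  Nat.card {p : n.Partition // IsSchur p}

end SchurSeries

open SchurSeries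

/-! Both sides are compared with the polynomials A_n that generate the Schur partitions with all
parts below 3n. Splitting by the largest part gives A_n a three-term recurrence
(`schurPoly_three_mul_add_two`).

Series side: give the summand a factor x^(n₁ + 2n₂₁ + 2n₂₂). Shifting one index at a time yields
q-difference equations, which at x = q^(3j) combine into a five-term recurrence. This factors
through a three-term operator, and the other factor annihilates only 0 (`defect_eq_zero`). The
resulting `partSum_recurrence` is the transpose of the one for A_n, so a bilinear expression in the
two is independent of n (`partSum_zero_eq`). Letting n → ∞, the triple series is lim A_n.

Product side: let U(z) be the generating function of A_n / (q³;q³)_n. Then (1-z) U(z) =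
(1+zq)(1+zq²) U(zq³), and iteration together with z → 1 gives lim A_n = (-q;q³)_∞ (-q²;q³)_∞.
Euler's 1+y = (1-y²)/(1-y) turns this into the stated product.

Complex q: all formal series involved have nonnegative coefficients bounded by s(k), and ∑ s(k)|q|^k
converges, so evaluation at q commutes with the limits and sums. -/

namespace SchurSeries

/-! ### Coefficientwise convergence of formal power series -/

section Topology

open PowerSeries.WithPiTopology

theorem tendsto_zero_of_X_pow_dvd {f : ℕ → ℤ⟦X⟧} (h : ∀ n, PowerSeries.X ^ n ∣ f n) :
    Tendsto f atTop (𝓝 0) := by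
  rw [tendsto_iff_coeff_tendsto]
  intro d
  refine tendsto_atTop_of_eventually_const (i₀ := d + 1) fun n hn => ?_
  simpa using PowerSeries.X_pow_dvd_iff.mp (h n) d hn

theorem tendsto_of_X_pow_dvd_sub {f g : ℕ → ℤ⟦X⟧} {a : ℤ⟦X⟧}
    (h : ∀ n, PowerSeries.X ^ n ∣ f n - g n) (hg : Tendsto g atTop (𝓝 a)) :
    Tendsto f atTop (𝓝 a) := by
  simpa using (tendsto_zero_of_X_pow_dvd h).add hg

theorem exists_tendsto_of_X_pow_dvd_succ_sub {f : ℕ → ℤ⟦X⟧}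
    (h : ∀ n, PowerSeries.X ^ n ∣ f (n + 1) - f n) : ∃ a, Tendsto f atTop (𝓝 a) := by
  -- From index k + 1 on, each step changes only degrees above k, so coefficient k is already final
  -- there.
  refine ⟨PowerSeries.mk fun k => PowerSeries.coeff k (f (k + 1)), ?_⟩
  rw [tendsto_iff_coeff_tendsto]
  intro d
  refine tendsto_atTop_of_eventually_const (i₀ := d + 1) fun n hn => ?_
  rw [PowerSeries.coeff_mk]
  induction n, hn using Nat.le_induction with
  | base => rfl
  | succ n hn ih =>
    rw [← ih, ← sub_eq_zero, ← map_sub]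
    exact PowerSeries.X_pow_dvd_iff.mp (h n) d hn

theorem hasFiniteSupport_coeff_X_pow_mul {ι : Type*} {E : ι → ℕ} (u : ι → ℤ⟦X⟧)
    (hE : Tendsto E cofinite atTop) (d : ℕ) :
    (Function.support fun i => PowerSeries.coeff d (PowerSeries.X ^ E i * u i)).Finite := by
  have h := hE.eventually_gt_atTop d
  rw [eventually_cofinite] at h
  refine h.subset fun i hi => ?_
  simp only [Function.mem_support, PowerSeries.coeff_X_pow_mul'] at hi
  simp only [Set.mem_ofPred_eq, not_lt]
  by_contra hlt
  exact hi (if_neg hlt)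

theorem summable_X_pow_mul {ι : Type*} {E : ι → ℕ} (u : ι → ℤ⟦X⟧)
    (hE : Tendsto E cofinite atTop) : Summable fun i => PowerSeries.X ^ E i * u i := by
  rw [summable_iff_summable_coeff]
  exact fun d => summable_of_hasFiniteSupport (hasFiniteSupport_coeff_X_pow_mul u hE d)

theorem X_pow_dvd_tsum {ι : Type*} {f : ι → ℤ⟦X⟧} (hf : Summable f) {N : ℕ}
    (h : ∀ i, PowerSeries.X ^ N ∣ f i) : PowerSeries.X ^ N ∣ ∑' i, f i := by
  rw [PowerSeries.X_pow_dvd_iff]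
  intro d hd
  rw [← ((hasSum_iff_hasSum_coeff ℤ).mp hf.hasSum d).tsum_eq]
  simp [fun i => PowerSeries.X_pow_dvd_iff.mp (h i) d hd]

end Topology

/-! ### Finite and infinite q-Pochhammer symbols -/

section qPoch

variable {R : Type*} [CommRing R]

theorem qPoch_zero (a q : R) : qPoch a q 0 = 1 := by simp [qPoch]

theorem qPoch_succ (a q : R) (n : ℕ) : qPoch a q (n + 1) = qPoch a q n * (1 - a * q ^ n) :=
  Finset.prod_range_succ _ _

theorem isUnit_of_constantCoeff_eq_one {f : ℤ⟦X⟧} (h : PowerSeries.constantCoeff f = 1) :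
    IsUnit f := by
  rw [PowerSeries.isUnit_iff_constantCoeff, h]; exact isUnit_one

theorem constantCoeff_qPoch_X_pow {m : ℕ} (hm : m ≠ 0) (l n : ℕ) :
    PowerSeries.constantCoeff (qPoch (PowerSeries.X ^ m : ℤ⟦X⟧) (PowerSeries.X ^ l) n) = 1 := by
  simp [qPoch, hm]

theorem isUnit_qPoch_X_pow {m : ℕ} (hm : m ≠ 0) (l n : ℕ) :
    IsUnit (qPoch (PowerSeries.X ^ m : ℤ⟦X⟧) (PowerSeries.X ^ l) n) :=
  isUnit_of_constantCoeff_eq_one (constantCoeff_qPoch_X_pow hm l n)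

theorem X_pow_dvd_qPoch_succ_sub (m : ℕ) {l : ℕ} (hl : l ≠ 0) (n : ℕ) :
    (PowerSeries.X : ℤ⟦X⟧) ^ n ∣ qPoch (PowerSeries.X ^ m) (PowerSeries.X ^ l) (n + 1)
      - qPoch (PowerSeries.X ^ m) (PowerSeries.X ^ l) n := by
  have h : (PowerSeries.X : ℤ⟦X⟧) ^ n ∣ (PowerSeries.X ^ l) ^ n := by
    rw [← pow_mul]; exact pow_dvd_pow _ (Nat.le_mul_of_pos_left n (Nat.pos_of_ne_zero hl))
  obtain ⟨c, hc⟩ := h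
  rw [qPoch_succ, hc]
  exact ⟨-(qPoch (PowerSeries.X ^ m) (PowerSeries.X ^ l) n * PowerSeries.X ^ m * c), by ring⟩

theorem tendsto_qPoch_X_pow (m : ℕ) {l : ℕ} (hl : l ≠ 0) :
    Tendsto (qPoch (PowerSeries.X ^ m : ℤ⟦X⟧) (PowerSeries.X ^ l)) atTop
      (𝓝 (qPochInf (PowerSeries.X ^ m) (PowerSeries.X ^ l))) :=
  tendsto_nhds_limUnder (exists_tendsto_of_X_pow_dvd_succ_sub (X_pow_dvd_qPoch_succ_sub m hl))

end qPoch

/-! ### Recurrences for the Schur polynomials -/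

section FiniteSchurSets

/-- The separation condition of Schur's theorem for a finite set of parts. -/
def IsSchurSet (t : Finset ℕ) : Prop :=
  ∀ a ∈ t, ∀ b ∈ t, a < b → a + 3 ≤ b ∧ (3 ∣ a → 3 ∣ b → a + 6 ≤ b)

instance : DecidablePred IsSchurSet := fun t => by unfold IsSchurSet; infer_instance

/-- The generating polynomial of the Schur partitions all of whose parts are less than `m`. -/
def schurPoly {R : Type*} [CommRing R] (q : R) (m : ℕ) : R :=
  ∑ t ∈ (Finset.Ico 1 m).powerset, if IsSchurSet t then q ^ (∑ i ∈ t, i) else 0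

theorem IsSchurSet.mono {s t : Finset ℕ} (h : s ⊆ t) (ht : IsSchurSet t) : IsSchurSet s :=
  fun a ha b hb => ht a (h ha) b (h hb)

/-- The strict upper bound for the other parts of a Schur partition with largest part `m`. -/
def gap (m : ℕ) : ℕ := if 3 ∣ m then m - 3 else m - 2

/-- If 3 ∣ m, the part m - 3 is a forbidden multiple of 3, and the next multiple down, m - 6, is
allowed. So a single upper bound encodes both separation conditions. -/
theorem isSchurSet_insert {m : ℕ} {t : Finset ℕ} (ht : t ⊆ Finset.Ico 1 m) :
    IsSchurSet (insert m t) ↔ t ⊆ Finset.Ico 1 (gap m) ∧ IsSchurSet t := by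
  constructor
  · intro h
    refine ⟨fun a ha => ?_, h.mono (Finset.subset_insert _ _)⟩
    have h1 := Finset.mem_Ico.mp (ht ha)
    have h2 := h a (Finset.mem_insert_of_mem ha) m (Finset.mem_insert_self _ _) h1.2
    rw [Finset.mem_Ico, gap]
    split_ifs with h3
    · refine ⟨h1.1, ?_⟩
      by_contra h4
      have h5 : 3 ∣ a := by omega
      have := h2.2 h5 h3
      omega
    · omega
  · rintro ⟨h1, h2⟩ a ha b hb hab
    have key : ∀ c ∈ t, c + 3 ≤ m ∧ (3 ∣ c → 3 ∣ m → c + 6 ≤ m) := by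
      intro c hc
      have := Finset.mem_Ico.mp (h1 hc)
      rw [gap] at this
      split_ifs at this <;> omega
    rcases Finset.mem_insert.mp ha with rfl | ha' <;> rcases Finset.mem_insert.mp hb with rfl | hb'
    · omega
    · have := (Finset.mem_Ico.mp (ht hb')).2
      omega
    · exact key a ha'
    · exact h2 a ha' b hb' hab

variable {R : Type*} [CommRing R] (q : R)

theorem schurPoly_of_le_one {m : ℕ} (hm : m ≤ 1) : schurPoly q m = 1 := by
  rw [schurPoly, Finset.Ico_eq_empty (by omega)]
  simp [IsSchurSet]

/-- The two summands correspond to m being absent or present as a part. -/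
theorem schurPoly_succ {m : ℕ} (hm : 1 ≤ m) :
    schurPoly q (m + 1) = schurPoly q m + q ^ m * schurPoly q (gap m) := by
  have hgap : gap m ≤ m := by rw [gap]; split_ifs <;> omega
  rw [schurPoly, ← Finset.insert_Ico_right_eq_Ico_add_one hm,
    Finset.sum_powerset_insert (by simp)]
  congr 1
  rw [schurPoly, Finset.mul_sum]
  symm
  refine Finset.sum_subset_zero_on_sdiff
    (Finset.powerset_mono.mpr (Finset.Ico_subset_Ico_right hgap)) ?_ ?_
  · intro t ht
    rw [Finset.mem_sdiff, Finset.mem_powerset, Finset.mem_powerset] at ht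
    rw [if_neg]
    rw [isSchurSet_insert ht.1]
    exact fun h => ht.2 h.1
  · intro t ht
    rw [Finset.mem_powerset] at ht
    have ht' := ht.trans (Finset.Ico_subset_Ico_right hgap)
    have hmt : m ∉ t := fun h => by simpa using ht' h
    simp only [isSchurSet_insert ht', ht, true_and, Finset.sum_insert hmt, pow_add]
    split_ifs <;> simp

theorem schurPoly_three : schurPoly q 3 = 1 + q + q ^ 2 := by
  have h1 := schurPoly_succ q (m := 1) le_rfl
  have h2 := schurPoly_succ q (m := 2) (by norm_num)
  simp only [gap] at h1 h2
  norm_num [schurPoly_of_le_one] at h1 h2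
  rw [h2, h1]

theorem schurPoly_three_mul_add_two (n : ℕ) :
    schurPoly q (3 * (n + 2)) =
      (1 + q ^ (3 * n + 4) + q ^ (3 * n + 5)) * schurPoly q (3 * (n + 1))
        + q ^ (3 * n + 3) * (1 - q ^ (3 * n + 3)) * schurPoly q (3 * n) := by
  have h1 := schurPoly_succ q (m := 3 * n + 2) (by omega)
  have h2 := schurPoly_succ q (m := 3 * n + 3) (by omega)
  have h3 := schurPoly_succ q (m := 3 * n + 4) (by omega)
  have h4 := schurPoly_succ q (m := 3 * n + 5) (by omega)
  rw [show gap (3 * n + 2) = 3 * n by rw [gap, if_neg (by omega)]; omega] at h1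
  rw [show gap (3 * n + 3) = 3 * n by rw [gap, if_pos (by omega)]; omega] at h2
  rw [show gap (3 * n + 4) = 3 * n + 2 by rw [gap, if_neg (by omega)]; omega] at h3
  rw [show gap (3 * n + 5) = 3 * n + 3 by rw [gap, if_neg (by omega)]; omega] at h4
  rw [show 3 * (n + 2) = 3 * n + 5 + 1 by ring, show 3 * (n + 1) = 3 * n + 3 by ring]
  norm_num only [add_assoc] at h1 h2 h3 h4 ⊢
  rw [h4, h3, h2]
  -- Eliminating `schurPoly q (3 * n + 2)` through `h1` produces the factor 1 - q^(3n+3).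
  linear_combination (-q ^ (3 * n + 4)) * h1

end FiniteSchurSets

end SchurSeries

namespace SchurSeries

/-! ### The triple series as the limit of the Schur polynomials -/

section TripleSeries

open PowerSeries (X)

theorem expo_succ_left (n a b : ℕ) :
    expo (n + 1) a b = expo n a b + (4 * n + 6 * a + 6 * b + 1) := by
  zify; rw [cast_expo, cast_expo]; push_cast; ring

theorem expo_succ_middle (n a b : ℕ) :
    expo n (a + 1) b = expo n a b + (6 * n + 12 * a + 12 * b + 5) := by
  zify; rw [cast_expo, cast_expo]; push_cast; ring

theorem expo_succ_right (n a b : ℕ) :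
    expo n a (b + 1) = expo n a b + (6 * n + 12 * a + 12 * b + 7) := by
  zify; rw [cast_expo, cast_expo]; push_cast; ring

theorem le_expo (n a b : ℕ) : n + a + b ≤ expo n a b := by
  have h1 : 2 * a ≤ 6 * a ^ 2 := by nlinarith [Nat.le_self_pow two_ne_zero a]
  have h2 : 2 * n ≤ 2 * n ^ 2 := by nlinarith [Nat.le_self_pow two_ne_zero n]
  unfold expo
  have := Nat.zero_le (6 * b ^ 2)
  have := Nat.zero_le (12 * a * b)
  have := Nat.zero_le (6 * (a + b) * n)
  omega

theorem tendsto_cofinite_of_le {E : ℕ × ℕ × ℕ → ℕ} (h : ∀ n, n.1 + n.2.1 + n.2.2 ≤ E n) :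
    Tendsto E cofinite atTop := by
  rw [tendsto_atTop]
  intro k
  rw [eventually_cofinite]
  refine (Finset.finite_toSet
    (Finset.range k ×ˢ Finset.range k ×ˢ Finset.range k)).subset fun n hn => ?_
  have := h n
  simp only [Set.mem_ofPred_eq, not_le] at hn
  simp only [Finset.coe_product, Finset.coe_range, Set.mem_prod, Set.mem_Iio]
  omega

/-- The general term of the triple series, weighted by `q ^ (α n₁ + β n₂₁ + γ n₂₂)`. -/
noncomputable def weightedTerm (α β γ : ℕ) (n : ℕ × ℕ × ℕ) : ℤ⟦X⟧ :=
  X ^ (expo n.1 n.2.1 n.2.2 + (α * n.1 + β * n.2.1 + γ * n.2.2)) *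
    Ring.inverse (den X n.1 n.2.1 n.2.2)

/-- The triple series, weighted by `q ^ (α n₁ + β n₂₁ + γ n₂₂)`. -/
noncomputable def weightedSum (α β γ : ℕ) : ℤ⟦X⟧ := ∑' n, weightedTerm α β γ n

theorem summable_weightedTerm (α β γ : ℕ) : Summable (weightedTerm α β γ) :=
  summable_X_pow_mul _ (tendsto_cofinite_of_le fun n => (le_expo _ _ _).trans (by omega))

theorem formalTerm_eq_weightedTerm : formalTerm = weightedTerm 0 0 0 := by
  ext1 n; simp [formalTerm, weightedTerm]

theorem hasSum_formalTerm : HasSum formalTerm (weightedSum 0 0 0) :=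
  formalTerm_eq_weightedTerm ▸ (summable_weightedTerm 0 0 0).hasSum

theorem mul_ringInverse_of_mul_eq {R : Type*} [CommRing R] {d e c : R} (hd : IsUnit d)
    (he : IsUnit e) (h : d * c = e) : c * Ring.inverse e = Ring.inverse d := by
  rw [← Ring.inverse_mul_cancel_left d (c * Ring.inverse e) hd, ← mul_assoc d, h,
    Ring.mul_inverse_cancel e he, mul_one]

theorem inverse_den_succ_left (n a b : ℕ) :
    (1 - X ^ (n + 1)) * Ring.inverse (den (X : ℤ⟦X⟧) (n + 1) a b) = Ring.inverse (den X n a b) :=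
  mul_ringInverse_of_mul_eq (isUnit_den _ _ _) (isUnit_den _ _ _) (by
    simp only [den, qPoch_succ]; ring)

theorem inverse_den_succ_middle (n a b : ℕ) :
    (1 - X ^ (6 * (a + 1))) * Ring.inverse (den (X : ℤ⟦X⟧) n (a + 1) b) =
      Ring.inverse (den X n a b) :=
  mul_ringInverse_of_mul_eq (isUnit_den _ _ _) (isUnit_den _ _ _) (by
    simp only [den, qPoch_succ]; ring)

theorem inverse_den_succ_right (n a b : ℕ) :
    (1 - X ^ (6 * (b + 1))) * Ring.inverse (den (X : ℤ⟦X⟧) n a (b + 1)) =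
      Ring.inverse (den X n a b) :=
  mul_ringInverse_of_mul_eq (isUnit_den _ _ _) (isUnit_den _ _ _) (by
    simp only [den, qPoch_succ]; ring)

theorem tsum_eq_tsum_comp {ι M : Type*} [AddCommMonoid M] [TopologicalSpace M] {f : ι → M}
    {g : ι → ι} (hg : Function.Injective g) (h : ∀ i ∉ Set.range g, f i = 0) :
    ∑' i, f i = ∑' i, f (g i) :=
  (hg.tsum_eq fun i hi => by_contra fun hr => hi (h i hr)).symm

/-- The difference of weights contributes 1 - q^n₁, which kills the terms with n₁ = 0 and otherwise
cancels the last factor of (q;q)_{n₁}. After the shift of n₁ the exponent grows by a linear form in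
the indices, which only changes the weights. The other two indices work alike, with steps of 6
because their base is q⁶. -/
theorem weightedSum_sub_left (α β γ : ℕ) :
    weightedSum α β γ - weightedSum (α + 1) β γ =
      X ^ (α + 1) * weightedSum (α + 4) (β + 6) (γ + 6) := by
  rw [weightedSum, weightedSum, weightedSum, ← (summable_weightedTerm _ _ _).tsum_sub
    (summable_weightedTerm _ _ _), ← (summable_weightedTerm _ _ _).tsum_mul_left,
    tsum_eq_tsum_comp (g := fun n : ℕ × ℕ × ℕ => (n.1 + 1, n.2)) (fun m n h => by
      simpa [Prod.ext_iff] using h)]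
  · refine tsum_congr fun ⟨n, a, b⟩ => ?_
    simp only [weightedTerm]
    rw [← inverse_den_succ_left n a b, expo_succ_left]
    ring
  · rintro ⟨_ | n, a, b⟩ h
    · simp [weightedTerm]
    · exact absurd ⟨(n, a, b), rfl⟩ h

theorem weightedSum_sub_middle (α β γ : ℕ) :
    weightedSum α β γ - weightedSum α (β + 6) γ =
      X ^ (β + 5) * weightedSum (α + 6) (β + 12) (γ + 12) := by
  rw [weightedSum, weightedSum, weightedSum, ← (summable_weightedTerm _ _ _).tsum_sub
    (summable_weightedTerm _ _ _), ← (summable_weightedTerm _ _ _).tsum_mul_left,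
    tsum_eq_tsum_comp (g := fun n : ℕ × ℕ × ℕ => (n.1, n.2.1 + 1, n.2.2)) (fun m n h => by
      simpa [Prod.ext_iff] using h)]
  · refine tsum_congr fun ⟨n, a, b⟩ => ?_
    simp only [weightedTerm]
    rw [← inverse_den_succ_middle n a b, expo_succ_middle]
    ring
  · rintro ⟨n, _ | a, b⟩ h
    · simp [weightedTerm]
    · exact absurd ⟨(n, a, b), rfl⟩ h

theorem weightedSum_sub_right (α β γ : ℕ) :
    weightedSum α β γ - weightedSum α β (γ + 6) =
      X ^ (γ + 7) * weightedSum (α + 6) (β + 12) (γ + 12) := by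
  rw [weightedSum, weightedSum, weightedSum, ← (summable_weightedTerm _ _ _).tsum_sub
    (summable_weightedTerm _ _ _), ← (summable_weightedTerm _ _ _).tsum_mul_left,
    tsum_eq_tsum_comp (g := fun n : ℕ × ℕ × ℕ => (n.1, n.2.1, n.2.2 + 1)) (fun m n h => by
      simpa [Prod.ext_iff] using h)]
  · refine tsum_congr fun ⟨n, a, b⟩ => ?_
    simp only [weightedTerm]
    rw [← inverse_den_succ_right n a b, expo_succ_right]
    ring
  · rintro ⟨n, a, _ | b⟩ h
    · simp [weightedTerm]
    · exact absurd ⟨(n, a, b), rfl⟩ h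

/-- The triple series with a factor `x` for every part, evaluated at `x = q ^ (3 j)`. -/
noncomputable def partSum (j : ℕ) : ℤ⟦X⟧ := weightedSum (3 * j) (6 * j) (6 * j)

theorem X_pow_dvd_partSum_sub_one (j : ℕ) : (X : ℤ⟦X⟧) ^ j ∣ partSum j - 1 := by
  rw [partSum, weightedSum, (summable_weightedTerm _ _ _).tsum_eq_add_tsum_ite (0, 0, 0)]
  have h0 : weightedTerm (3 * j) (6 * j) (6 * j) (0, 0, 0) = 1 := by
    simp [weightedTerm, expo, den, qPoch_zero]
  rw [h0, add_sub_cancel_left]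
  have hs := (hasSum_ite_sub_hasSum (summable_weightedTerm (3 * j) (6 * j) (6 * j)).hasSum
    (0, 0, 0)).summable
  refine X_pow_dvd_tsum hs fun ⟨n, a, b⟩ => ?_
  split_ifs with h
  · exact dvd_zero _
  · refine Dvd.dvd.mul_right (pow_dvd_pow _ ?_) _
    have : 1 ≤ n + a + b := by
      by_contra h'
      exact h (by simp only [Prod.mk.injEq]; omega)
    dsimp only
    nlinarith

/-- The deviation of `partSum` from the three-term recurrence of the Schur partitions. -/
noncomputable def defect (j : ℕ) : ℤ⟦X⟧ :=
  partSum j - (1 + X ^ (3 * j + 1) + X ^ (3 * j + 2)) * partSum (j + 1)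
    - X ^ (3 * j + 3) * (1 - X ^ (3 * j + 3)) * partSum (j + 2)

theorem defect_recurrence (j : ℕ) :
    defect j + X ^ (3 * j + 1) * (1 + X) * defect (j + 1) + X ^ (6 * j + 6) * defect (j + 2)
      = 0 := by
  -- `e1`, `e2` raise the last two weights to those of `partSum (j + 1)`; `e3` removes the
  -- unbalanced series (3j+6, 6j+18, 6j+12) created by `e2`. The remaining relations raise the first
  -- weight by 1 at a time until only values of `partSum` survive.
  have e1 := weightedSum_sub_middle (3 * j) (6 * j) (6 * j)
  have e2 := weightedSum_sub_right (3 * j) (6 * j + 6) (6 * j)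
  have e3 := weightedSum_sub_middle (3 * j + 6) (6 * j + 12) (6 * j + 12)
  have l00 := weightedSum_sub_left (3 * j) (6 * j + 6) (6 * j + 6)
  have l10 := weightedSum_sub_left (3 * j + 1) (6 * j + 6) (6 * j + 6)
  have l20 := weightedSum_sub_left (3 * j + 2) (6 * j + 6) (6 * j + 6)
  have l11 := weightedSum_sub_left (3 * j + 4) (6 * j + 12) (6 * j + 12)
  have l21 := weightedSum_sub_left (3 * j + 5) (6 * j + 12) (6 * j + 12)
  have l22 := weightedSum_sub_left (3 * j + 8) (6 * j + 18) (6 * j + 18)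
  simp only [defect, partSum]
  ring_nf at *
  linear_combination e1 + e2 - X ^ (6 * j + 7) * e3 + l00 + l10 + l20 + X ^ (3 * j + 1) * l11 +
    X ^ (3 * j + 1) * (1 + X) * l21 + X ^ (6 * j + 6) * l22

/-- The coefficients of `defect (j + 1)` and `defect (j + 2)` in the recurrence are divisible by X,
so divisibility of all defects by X^n improves to X^(n+1). -/
theorem defect_eq_zero (j : ℕ) : defect j = 0 := by
  have h : ∀ n j, (X : ℤ⟦X⟧) ^ n ∣ defect j := by
    intro n
    induction n with
    | zero => simp
    | succ n ih =>
      intro j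
      obtain ⟨c, hc⟩ := ih (j + 1)
      obtain ⟨d, hd⟩ := ih (j + 2)
      have := defect_recurrence j
      rw [hc, hd] at this
      exact ⟨-(X ^ (3 * j) * (1 + X) * c + X ^ (6 * j + 5) * d), by linear_combination this⟩
  ext k
  exact PowerSeries.X_pow_dvd_iff.mp (h (k + 1) j) k (Nat.lt_succ_self k)

theorem partSum_recurrence (j : ℕ) :
    partSum j = (1 + X ^ (3 * j + 1) + X ^ (3 * j + 2)) * partSum (j + 1)
      + X ^ (3 * j + 3) * (1 - X ^ (3 * j + 3)) * partSum (j + 2) := by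
  have := defect_eq_zero j
  rw [defect] at this
  linear_combination this

/-- The right side does not depend on n: expanding `partSum (n + 1)` by its recurrence and
collecting `partSum (n + 2)` reproduces the recurrence of `schurPoly`. -/
theorem partSum_zero_eq (n : ℕ) :
    partSum 0 = schurPoly X (3 * (n + 1)) * partSum (n + 1)
      + X ^ (3 * n + 3) * (1 - X ^ (3 * n + 3)) * schurPoly X (3 * n) * partSum (n + 2) := by
  induction n with
  | zero =>
    have h := partSum_recurrence 0
    simp only [mul_zero, zero_add, mul_one] at h ⊢
    rw [schurPoly_three, schurPoly_of_le_one _ (Nat.zero_le 1)]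
    linear_combination h
  | succ n ih =>
    rw [ih, partSum_recurrence (n + 1), schurPoly_three_mul_add_two]
    ring

theorem X_pow_dvd_schurPoly_sub_partSum_zero (n : ℕ) :
    (X : ℤ⟦X⟧) ^ n ∣ schurPoly X (3 * (n + 1)) - partSum 0 := by
  obtain ⟨c, hc⟩ := (pow_dvd_pow _ n.le_succ).trans (X_pow_dvd_partSum_sub_one (n + 1))
  rw [partSum_zero_eq n]
  exact ⟨-(schurPoly X (3 * (n + 1)) * c) - X ^ (2 * n + 3) * (1 - X ^ (3 * n + 3)) *
    schurPoly X (3 * n) * partSum (n + 2), by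
      linear_combination (-schurPoly X (3 * (n + 1))) * hc⟩

theorem tendsto_schurPoly :
    Tendsto (fun n => schurPoly (X : ℤ⟦X⟧) (3 * (n + 1))) atTop (𝓝 (weightedSum 0 0 0)) :=
  tendsto_of_X_pow_dvd_sub X_pow_dvd_schurPoly_sub_partSum_zero tendsto_const_nhds

end TripleSeries

end SchurSeries

namespace SchurSeries

/-! ### From the Schur polynomials to the infinite product -/

section ProductSide

open PowerSeries (X)

/-- The polynomials `schurPoly X (3 n)`, divided by `(q³; q³)_n`. -/
noncomputable def schurQuot (n : ℕ) : ℤ⟦X⟧ :=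
  schurPoly X (3 * n) * Ring.inverse (qPoch (X ^ 3) (X ^ 3) n)

theorem schurQuot_mul_qPoch (n : ℕ) :
    schurQuot n * qPoch (X ^ 3) (X ^ 3) n = schurPoly X (3 * n) := by
  rw [schurQuot, mul_assoc, Ring.inverse_mul_cancel _ (isUnit_qPoch_X_pow three_ne_zero _ _),
    mul_one]

theorem schurQuot_zero : schurQuot 0 = 1 := by
  simp [schurQuot, qPoch_zero, schurPoly_of_le_one]

theorem schurQuot_one : (1 - X ^ 3) * schurQuot 1 = 1 + X + X ^ 2 := by
  have h := schurQuot_mul_qPoch 1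
  rw [mul_one, schurPoly_three, qPoch_succ, qPoch_zero] at h
  linear_combination h

/-- Division by (q³;q³)_n absorbs the factor 1 - q^(3n+3), leaving coefficients linear in q^(3n), so
that the generating function satisfies a first-order q-difference equation. -/
theorem schurQuot_add_two (n : ℕ) :
    (1 - X ^ (3 * n + 6)) * schurQuot (n + 2) =
      (1 + X ^ (3 * n + 4) + X ^ (3 * n + 5)) * schurQuot (n + 1)
        + X ^ (3 * n + 3) * schurQuot n := by
  have h0 := schurQuot_mul_qPoch n
  have h1 := schurQuot_mul_qPoch (n + 1)
  have h2 := schurQuot_mul_qPoch (n + 2)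
  have h := schurPoly_three_mul_add_two (X : ℤ⟦X⟧) n
  have hu := isUnit_qPoch_X_pow three_ne_zero 3 (n + 1)
  rw [← hu.mul_left_inj]
  rw [← h0, ← h1, ← h2, qPoch_succ _ _ (n + 1)] at h
  simp only [qPoch_succ] at h ⊢
  linear_combination h

/-- `∑ n, u n * q ^ (3 k n)` for `u = schurQuot`. -/
noncomputable def quotSum (k : ℕ) : ℤ⟦X⟧ := ∑' n, X ^ (3 * (k + 1) * n) * schurQuot n

theorem tendsto_mul_cofinite {m : ℕ} (hm : 0 < m) (l : ℕ) :
    Tendsto (fun n => m * n + l) cofinite atTop := by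
  rw [Nat.cofinite_eq_atTop]
  exact tendsto_atTop_mono (fun n => (Nat.le_mul_of_pos_left n hm).trans (Nat.le_add_right _ _))
    tendsto_id

theorem summable_quotSum (k l i : ℕ) :
    Summable fun n => X ^ (3 * (k + 1) * n + l) * schurQuot (n + i) :=
  summable_X_pow_mul _ (tendsto_mul_cofinite (by positivity) l)

theorem hasSum_quotSum (k : ℕ) :
    HasSum (fun n => X ^ (3 * (k + 1) * n) * schurQuot n) (quotSum k) :=
  (summable_quotSum k 0 0).hasSum

theorem hasSum_quotSum_shift (k : ℕ) :
    HasSum (fun n => X ^ (3 * (k + 1) * (n + 1)) * schurQuot (n + 1)) (quotSum k - 1) := by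
  rw [hasSum_nat_add_iff (f := fun n => X ^ (3 * (k + 1) * n) * schurQuot n) 1]
  simpa [schurQuot_zero] using hasSum_quotSum k

theorem hasSum_quotSum_shift_two (k : ℕ) :
    HasSum (fun n => X ^ (3 * (k + 1) * (n + 2)) * schurQuot (n + 2))
      (quotSum k - 1 - X ^ (3 * (k + 1)) * schurQuot 1) := by
  rw [hasSum_nat_add_iff (f := fun n => X ^ (3 * (k + 1) * (n + 1)) * schurQuot (n + 1)) 1]
  simpa using hasSum_quotSum_shift k

theorem hasSum_congr_fun {ι M : Type*} [AddCommMonoid M] [TopologicalSpace M] {f g : ι → M}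
    {a : M} (h : ∀ i, f i = g i) (hg : HasSum g a) : HasSum f a :=
  (funext h : f = g) ▸ hg

/-- This is (1-z) U(z) = (1+zq)(1+zq²) U(zq³) at z = q^(3(k+1)): multiply `schurQuot_add_two` by
z^(n+2) and sum over n. The boundary terms are settled by `schurQuot_one`. -/
theorem quotSum_succ (k : ℕ) :
    (1 - X ^ (3 * k + 3)) * quotSum k =
      (1 + X ^ (3 * k + 4)) * (1 + X ^ (3 * k + 5)) * quotSum (k + 1) := by
  have h := ((hasSum_quotSum_shift_two k).sub (hasSum_quotSum_shift_two (k + 1))).sub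
    ((((hasSum_quotSum_shift k).mul_left (X ^ (3 * k + 3))).add
      ((hasSum_quotSum_shift (k + 1)).mul_left (X ^ (3 * k + 3) * (X + X ^ 2)))).add
      ((hasSum_quotSum (k + 1)).mul_left (X ^ (6 * k + 9))))
  replace h : HasSum (fun _ : ℕ => (0 : ℤ⟦X⟧)) _ := hasSum_congr_fun (fun n => by
    linear_combination (-X ^ (3 * (k + 1) * (n + 2))) * schurQuot_add_two n) h
  have h0 := h.unique hasSum_zero
  linear_combination h0 + X ^ (3 * k + 3) * schurQuot_one

theorem quotSum_mul_qPoch (n : ℕ) :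
    (1 + X) * (1 + X ^ 2) * quotSum 0 * qPoch (X ^ 3) (X ^ 3) n =
      qPoch (-X) (X ^ 3) (n + 1) * qPoch (-X ^ 2) (X ^ 3) (n + 1) * quotSum n := by
  induction n with
  | zero => simp [qPoch_succ, qPoch_zero]
  | succ n ih =>
    have h := quotSum_succ n
    rw [qPoch_succ _ _ (n + 1), qPoch_succ (-X ^ 2) _ (n + 1), qPoch_succ _ _ n]
    linear_combination (1 - X ^ (3 * n + 3)) * ih +
      qPoch (-X) (X ^ 3) (n + 1) * qPoch (-X ^ 2) (X ^ 3) (n + 1) * h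

theorem X_pow_dvd_quotSum_sub_one (k : ℕ) : (X : ℤ⟦X⟧) ^ k ∣ quotSum k - 1 := by
  rw [← (hasSum_quotSum_shift k).tsum_eq]
  exact X_pow_dvd_tsum (hasSum_quotSum_shift k).summable fun n =>
    Dvd.dvd.mul_right (pow_dvd_pow _ (by nlinarith)) _

/-- The limit is the value of (1-z) U(z) at z = 1, formally the case k = -1 of `quotSum_succ`. It is
obtained by telescoping the recurrence. -/
theorem tendsto_schurQuot :
    Tendsto schurQuot atTop (𝓝 ((1 + X) * (1 + X ^ 2) * quotSum 0)) := by
  have h := ((hasSum_quotSum_shift_two 0).add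
    ((hasSum_quotSum_shift 0).mul_left (X + X ^ 2))).add
    ((hasSum_quotSum 0).mul_left (X ^ 3))
  replace h : HasSum (fun n => schurQuot (n + 2) - schurQuot (n + 1)) _ :=
    hasSum_congr_fun (fun n => by linear_combination schurQuot_add_two n) h
  have h2 := (h.tendsto_sum_nat).add_const (schurQuot 1)
  simp only [Finset.sum_range_sub (fun n => schurQuot (n + 1)), zero_add, sub_add_cancel] at h2
  refine (tendsto_add_atTop_iff_nat 1).mp ?_
  convert h2 using 2
  linear_combination -schurQuot_one

/-- The partial products of `(-q; q³)_∞ (-q²; q³)_∞` converge to the sum of the triple series. -/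
theorem tendsto_distinct_product :
    Tendsto (fun n => qPoch (-X : ℤ⟦X⟧) (X ^ 3) n * qPoch (-X ^ 2) (X ^ 3) n) atTop
      (𝓝 (weightedSum 0 0 0)) := by
  have h1 : Tendsto (fun n => schurQuot n * qPoch (X ^ 3 : ℤ⟦X⟧) (X ^ 3) n) atTop
      (𝓝 (weightedSum 0 0 0)) := by
    simp only [schurQuot_mul_qPoch]
    exact (tendsto_add_atTop_iff_nat 1).mp tendsto_schurPoly
  have hE := tendsto_qPoch_X_pow 3 three_ne_zero
  have h2 := tendsto_nhds_unique h1 (tendsto_schurQuot.mul hE)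
  have h3 := hE.const_mul ((1 + X) * (1 + X ^ 2) * quotSum 0)
  rw [← h2] at h3
  refine (tendsto_add_atTop_iff_nat 1).mp (tendsto_of_X_pow_dvd_sub (fun n => ?_) h3)
  rw [quotSum_mul_qPoch]
  obtain ⟨c, hc⟩ := X_pow_dvd_quotSum_sub_one n
  exact ⟨-(qPoch (-X) (X ^ 3) (n + 1) * qPoch (-X ^ 2) (X ^ 3) (n + 1) * c), by
    linear_combination (-(qPoch (-X) (X ^ 3) (n + 1) * qPoch (-X ^ 2) (X ^ 3) (n + 1))) * hc⟩

/-- The denominator of the product side, truncated. -/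
def productDen {R : Type*} [CommRing R] (q : R) (n : ℕ) : R :=
  qPoch q (q ^ 6) n * qPoch (q ^ 5) (q ^ 6) n

/-- A division-free finite form of Euler's trick; the auxiliary products in q² and q⁴ have the same
limit on both sides and cancel there. -/
theorem distinct_product_mul_productDen {R : Type*} [CommRing R] (q : R) (n : ℕ) :
    qPoch (-q) (q ^ 3) (2 * n) * qPoch (-q ^ 2) (q ^ 3) (2 * n) * productDen q n
        * (qPoch (q ^ 2) (q ^ 6) n * qPoch (q ^ 4) (q ^ 6) n) =
      qPoch (q ^ 2) (q ^ 6) (2 * n) * qPoch (q ^ 4) (q ^ 6) (2 * n) := by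
  have h1 : ∀ m, qPoch (-q) (q ^ 3) m * qPoch q (q ^ 3) m = qPoch (q ^ 2) (q ^ 6) m := fun m => by
    simp only [qPoch, ← Finset.prod_mul_distrib]
    exact Finset.prod_congr rfl fun j _ => by ring
  have h2 : ∀ m, qPoch (-q ^ 2) (q ^ 3) m * qPoch (q ^ 2) (q ^ 3) m = qPoch (q ^ 4) (q ^ 6) m :=
    fun m => by
      simp only [qPoch, ← Finset.prod_mul_distrib]
      exact Finset.prod_congr rfl fun j _ => by ring
  have h3 : ∀ m, qPoch q (q ^ 3) (2 * m) = qPoch q (q ^ 6) m * qPoch (q ^ 4) (q ^ 6) m := by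
    intro m
    induction m with
    | zero => simp [qPoch_zero]
    | succ n ih =>
      rw [mul_add, mul_one, qPoch_succ, qPoch_succ, ih, qPoch_succ, qPoch_succ]; ring
  have h4 : ∀ m, qPoch (q ^ 2) (q ^ 3) (2 * m) =
      qPoch (q ^ 2) (q ^ 6) m * qPoch (q ^ 5) (q ^ 6) m := by
    intro m
    induction m with
    | zero => simp [qPoch_zero]
    | succ n ih =>
      rw [mul_add, mul_one, qPoch_succ, qPoch_succ, ih, qPoch_succ, qPoch_succ]; ring
  rw [← h1 (2 * n), ← h2 (2 * n), h3, h4, productDen]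
  ring

theorem tendsto_productDen :
    Tendsto (productDen (X : ℤ⟦X⟧)) atTop
      (𝓝 (qPochInf X (X ^ 6) * qPochInf (X ^ 5) (X ^ 6))) := by
  have h := tendsto_qPoch_X_pow 1 (l := 6) (by norm_num)
  rw [pow_one] at h
  exact h.mul (tendsto_qPoch_X_pow 5 (by norm_num))

theorem weightedSum_mul_product :
    weightedSum 0 0 0 * (qPochInf X (X ^ 6) * qPochInf (X ^ 5) (X ^ 6)) = 1 := by
  have hd : Tendsto (fun n : ℕ => 2 * n) atTop atTop :=
    tendsto_atTop_mono (fun n => Nat.le_mul_of_pos_left n two_pos) tendsto_id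
  have h2 := tendsto_qPoch_X_pow 2 (l := 6) (by norm_num)
  have h4 := tendsto_qPoch_X_pow 4 (l := 6) (by norm_num)
  have hl := ((tendsto_distinct_product.comp hd).mul tendsto_productDen).mul (h2.mul h4)
  have hr := (h2.comp hd).mul (h4.comp hd)
  have he := tendsto_nhds_unique (hl.congr fun n => distinct_product_mul_productDen X n) hr
  have hne : ∀ m : ℕ, m ≠ 0 → qPochInf (X ^ m : ℤ⟦X⟧) (X ^ 6) ≠ 0 := by
    intro m hm h0
    have hc := ((PowerSeries.WithPiTopology.continuous_constantCoeff ℤ).tendsto _).comp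
      (tendsto_qPoch_X_pow m (l := 6) (by norm_num))
    rw [h0, map_zero] at hc
    have := tendsto_nhds_unique hc (tendsto_const_nhds.congr fun n =>
      (constantCoeff_qPoch_X_pow hm 6 n).symm)
    exact zero_ne_one this
  have hne' := mul_ne_zero (hne 2 two_ne_zero) (hne 4 four_ne_zero)
  exact mul_right_cancel₀ hne' (he.trans (one_mul _).symm)

end ProductSide

end SchurSeries

namespace SchurSeries

/-! ### Counting Schur partitions and the growth of s -/

section Counting

open PowerSeries (X)

/-- Partitions satisfying Schur's condition correspond to finite sets of positive integers. -/
noncomputable def schurPartitionEquiv {k m : ℕ} (hkm : k < m) :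
    {p : k.Partition // IsSchur p} ≃
      {t // t ∈ {t ∈ (Finset.Ico 1 m).powerset | IsSchurSet t ∧ ∑ i ∈ t, i = k}} where
  toFun p := ⟨⟨p.1.parts, p.2.1⟩, by
    have hp := p.2.2
    simp only [Finset.mem_filter, Finset.mem_powerset]
    refine ⟨fun i hi => ?_, hp, ?_⟩
    · have hi' : i ∈ p.1.parts := hi
      rw [Finset.mem_Ico]
      exact ⟨p.1.parts_pos hi', (Nat.Partition.le_of_mem_parts hi').trans_lt hkm⟩
    · rw [Finset.sum_eq_multiset_sum]
      simpa using p.1.parts_sum⟩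
  invFun t := ⟨⟨t.1.val, fun {i} hi => by
      have ht := (Finset.mem_filter.mp t.2).1
      exact (Finset.mem_Ico.mp (Finset.mem_powerset.mp ht hi)).1, by
      have ht := (Finset.mem_filter.mp t.2).2.2
      rw [Finset.sum_eq_multiset_sum] at ht
      simpa using ht⟩, t.1.nodup, (Finset.mem_filter.mp t.2).2.1⟩
  left_inv _ := rfl
  right_inv _ := rfl

theorem s_eq_card {k m : ℕ} (hkm : k < m) :
    s k = ({t ∈ (Finset.Ico 1 m).powerset | IsSchurSet t ∧ ∑ i ∈ t, i = k} : Finset _).card := by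
  rw [s, Nat.card_congr (schurPartitionEquiv hkm), Nat.card_eq_fintype_card, Fintype.card_coe]

theorem coeff_schurPoly {k m : ℕ} (hkm : k < m) :
    PowerSeries.coeff k (schurPoly (X : ℤ⟦X⟧) m) = s k := by
  rw [s_eq_card hkm, schurPoly, map_sum, Finset.card_filter]
  push_cast
  refine Finset.sum_congr rfl fun t _ => ?_
  by_cases h : IsSchurSet t
  · simp [h, PowerSeries.coeff_X_pow, eq_comm]
  · simp [h]

theorem coeff_weightedSum_zero (k : ℕ) : PowerSeries.coeff k (weightedSum 0 0 0) = s k := by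
  have h := X_pow_dvd_schurPoly_sub_partSum_zero (k + 1)
  have h' := PowerSeries.X_pow_dvd_iff.mp h k (Nat.lt_succ_self k)
  rw [map_sub, coeff_schurPoly (by omega)] at h'
  exact (sub_eq_zero.mp h').symm

/-- The product expands over all sets of parts below n; the left side keeps only the Schur sets of
sum below n. -/
theorem sum_s_mul_pow_le {r : ℝ} (hr : 0 ≤ r) (n : ℕ) :
    ∑ k ∈ Finset.range n, (s k : ℝ) * r ^ k ≤ ∏ i ∈ Finset.Ico 1 n, (1 + r ^ i) := by
  have h : ∀ k ∈ Finset.range n, (s k : ℝ) * r ^ k = ∑ t ∈ (Finset.Ico 1 n).powerset,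
      if IsSchurSet t ∧ ∑ i ∈ t, i = k then r ^ k else 0 := fun k hk => by
    rw [s_eq_card (Finset.mem_range.mp hk), ← Finset.sum_filter, Finset.sum_const, nsmul_eq_mul]
  rw [Finset.sum_congr rfl h, Finset.sum_comm, Finset.prod_one_add]
  refine Finset.sum_le_sum fun t _ => ?_
  rw [Finset.prod_pow_eq_pow_sum]
  by_cases ht : IsSchurSet t
  · simp only [ht, true_and, Finset.sum_ite_eq]
    split_ifs
    · exact le_rfl
    · positivity
  · simp only [ht, false_and, if_false, Finset.sum_const_zero]
    positivity

theorem summable_s_mul_pow {r : ℝ} (hr : 0 ≤ r) (hr1 : r < 1) :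
    Summable fun k => (s k : ℝ) * r ^ k := by
  refine summable_of_sum_range_le (c := Real.exp (∑' i, r ^ i)) (fun k => by positivity)
    fun n => (sum_s_mul_pow_le hr n).trans ?_
  refine (Real.prod_one_add_le_exp_sum _ fun i => pow_nonneg hr i).trans (Real.exp_le_exp.mpr ?_)
  exact (summable_geometric_of_lt_one hr hr1).sum_le_tsum _ fun i _ => pow_nonneg hr i

end Counting

/-! ### Nonnegative coefficients and domination by s -/

section Nonnegativity

open PowerSeries (X)

theorem coeff_nonneg_of_one_sub_X_pow_mul {m : ℕ} (hm : m ≠ 0) {f : ℤ⟦X⟧}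
    (h : ∀ k, 0 ≤ PowerSeries.coeff k ((1 - X ^ m) * f)) (k : ℕ) : 0 ≤ PowerSeries.coeff k f := by
  induction k using Nat.strong_induction_on with
  | _ k ih =>
    have hk := h k
    rw [sub_mul, one_mul, map_sub, PowerSeries.coeff_X_pow_mul'] at hk
    split_ifs at hk with hmk
    · have := ih (k - m) (by omega)
      omega
    · omega

theorem coeff_one_sub_X_pow_mul_le (m : ℕ) {f : ℤ⟦X⟧} (h : ∀ k, 0 ≤ PowerSeries.coeff k f)
    (k : ℕ) : PowerSeries.coeff k ((1 - X ^ m) * f) ≤ PowerSeries.coeff k f := by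
  rw [sub_mul, one_mul, map_sub, PowerSeries.coeff_X_pow_mul']
  split_ifs
  · have := h (k - m)
    omega
  · omega

theorem coeff_nonneg_of_qPoch_mul {m : ℕ} (hm : m ≠ 0) (l n : ℕ) {f : ℤ⟦X⟧}
    (h : ∀ k, 0 ≤ PowerSeries.coeff k (qPoch (X ^ m) (X ^ l) n * f)) (k : ℕ) :
    0 ≤ PowerSeries.coeff k f := by
  induction n generalizing f k with
  | zero => simpa [qPoch_zero] using h k
  | succ n ih =>
    refine coeff_nonneg_of_one_sub_X_pow_mul (m := m + l * n) (by omega) (fun k => ?_) k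
    refine ih (f := (1 - X ^ (m + l * n)) * f) ?_ k
    intro k
    rw [← mul_assoc, pow_add, pow_mul, ← qPoch_succ]
    exact h k

theorem den_X_eq (n : ℕ × ℕ × ℕ) (f : ℤ⟦X⟧) :
    den X n.1 n.2.1 n.2.2 * f = qPoch (X ^ 1) (X ^ 1) n.1 * (qPoch (X ^ 6) (X ^ 6) n.2.1 *
      (qPoch (X ^ 6) (X ^ 6) n.2.2 * f)) := by
  rw [den, pow_one, mul_assoc, mul_assoc]

theorem den_mul_formalTerm (n : ℕ × ℕ × ℕ) :
    den X n.1 n.2.1 n.2.2 * formalTerm n = X ^ expo n.1 n.2.1 n.2.2 := by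
  rw [formalTerm, mul_left_comm, Ring.mul_inverse_cancel _ (isUnit_den _ _ _), mul_one]

theorem coeff_formalTerm_nonneg (n : ℕ × ℕ × ℕ) (k : ℕ) :
    0 ≤ PowerSeries.coeff k (formalTerm n) := by
  have h := den_mul_formalTerm n
  rw [den_X_eq] at h
  refine coeff_nonneg_of_qPoch_mul (m := 6) (by norm_num) 6 n.2.2 (coeff_nonneg_of_qPoch_mul (m := 6)
    (by norm_num) 6 n.2.1 (coeff_nonneg_of_qPoch_mul one_ne_zero 1 n.1 fun k => ?_)) k
  rw [h, PowerSeries.coeff_X_pow]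
  split_ifs <;> norm_num

theorem hasSum_coeff_formalTerm (k : ℕ) :
    HasSum (fun n => PowerSeries.coeff k (formalTerm n)) (s k : ℤ) := by
  rw [← coeff_weightedSum_zero]
  exact (PowerSeries.WithPiTopology.hasSum_iff_hasSum_coeff ℤ).mp hasSum_formalTerm k

theorem coeff_formalTerm_le (n : ℕ × ℕ × ℕ) (k : ℕ) :
    PowerSeries.coeff k (formalTerm n) ≤ s k :=
  le_hasSum (hasSum_coeff_formalTerm k) n fun j _ => coeff_formalTerm_nonneg j k

/-- The reciprocals of the partial products of the product side. -/
noncomputable def productInv (n : ℕ) : ℤ⟦X⟧ := Ring.inverse (productDen X n)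

theorem isUnit_productDen (n : ℕ) : IsUnit (productDen (X : ℤ⟦X⟧) n) := by
  have h := isUnit_qPoch_X_pow one_ne_zero 6 n
  rw [pow_one] at h
  exact h.mul (isUnit_qPoch_X_pow (by norm_num) 6 n)

theorem productDen_mul_productInv (n : ℕ) : productDen X n * productInv n = 1 :=
  Ring.mul_inverse_cancel _ (isUnit_productDen n)

theorem productInv_succ (n : ℕ) :
    (1 - X ^ (6 * n + 5)) * ((1 - X ^ (6 * n + 1)) * productInv (n + 1)) = productInv n := by
  rw [← mul_assoc]
  refine mul_ringInverse_of_mul_eq (isUnit_productDen n) (isUnit_productDen (n + 1)) ?_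
  simp only [productDen, qPoch_succ]
  ring

theorem coeff_productInv_nonneg (n k : ℕ) : 0 ≤ PowerSeries.coeff k (productInv n) := by
  have h := productDen_mul_productInv n
  rw [productDen, mul_assoc] at h
  refine coeff_nonneg_of_qPoch_mul (m := 5) (by norm_num) 6 n (coeff_nonneg_of_qPoch_mul one_ne_zero
    6 n fun k => ?_) k
  rw [pow_one, h, PowerSeries.coeff_one]
  split_ifs <;> norm_num

/-- Monotonicity bounds each coefficient by its limit s(k), the majorant for dominated convergence.
-/
theorem monotone_coeff_productInv (k : ℕ) :
    Monotone fun n => PowerSeries.coeff k (productInv n) := by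
  refine monotone_nat_of_le_succ fun n => ?_
  have h := productInv_succ n
  have h1 : ∀ k, 0 ≤ PowerSeries.coeff k ((1 - X ^ (6 * n + 1)) * productInv (n + 1)) :=
    coeff_nonneg_of_one_sub_X_pow_mul (m := 6 * n + 5) (by omega)
      fun k => h ▸ coeff_productInv_nonneg n k
  rw [← h]
  exact (coeff_one_sub_X_pow_mul_le _ h1 k).trans
    (coeff_one_sub_X_pow_mul_le _ (coeff_productInv_nonneg (n + 1)) k)

theorem tendsto_productInv : Tendsto productInv atTop (𝓝 (weightedSum 0 0 0)) := by
  obtain ⟨w, hw⟩ := exists_tendsto_of_X_pow_dvd_succ_sub (f := productInv) fun n => by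
    rw [← productInv_succ n]
    exact ⟨(X ^ (5 * n + 5) * (1 - X ^ (6 * n + 1)) + X ^ (5 * n + 1)) * productInv (n + 1),
      by ring⟩
  have h1 := tendsto_nhds_unique ((tendsto_productDen.mul hw).congr productDen_mul_productInv)
    tendsto_const_nhds
  have h2 := weightedSum_mul_product
  convert hw using 2
  linear_combination w * h2 - weightedSum 0 0 0 * h1

theorem tendsto_coeff_productInv (k : ℕ) :
    Tendsto (fun n => PowerSeries.coeff k (productInv n)) atTop (𝓝 (s k : ℤ)) := by
  rw [← coeff_weightedSum_zero]
  exact (PowerSeries.WithPiTopology.tendsto_iff_coeff_tendsto ℤ _ _ _).mp tendsto_productInv k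

theorem coeff_productInv_le (n k : ℕ) : PowerSeries.coeff k (productInv n) ≤ s k :=
  (monotone_coeff_productInv k).ge_of_tendsto (tendsto_coeff_productInv k) n

end Nonnegativity

/-! ### Evaluation at complex q in the unit disc -/

section Evaluation

open PowerSeries (X)

variable {q : ℂ}

theorem hasSum_coeff_one_sub_X_pow_mul (m : ℕ) {f : ℤ⟦X⟧} {a : ℂ}
    (h : HasSum (fun k => ((PowerSeries.coeff k f : ℤ) : ℂ) * q ^ k) a) :
    HasSum (fun k => ((PowerSeries.coeff k ((1 - X ^ m) * f) : ℤ) : ℂ) * q ^ k)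
      ((1 - q ^ m) * a) := by
  have h1 : HasSum (fun k => ((PowerSeries.coeff k (X ^ m * f) : ℤ) : ℂ) * q ^ k) (q ^ m * a) := by
    rw [← (add_left_injective m).hasSum_iff]
    · refine hasSum_congr_fun (fun k => ?_) (h.mul_left (q ^ m))
      simp only [Function.comp_apply, PowerSeries.coeff_X_pow_mul]
      ring
    · intro k hk
      rw [PowerSeries.coeff_X_pow_mul', if_neg, Int.cast_zero, zero_mul]
      exact fun hmk => hk ⟨k - m, Nat.sub_add_cancel hmk⟩
  have h2 := h.sub h1
  rw [← one_sub_mul] at h2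
  refine hasSum_congr_fun (fun k => ?_) h2
  rw [sub_mul, one_mul, map_sub]
  push_cast
  ring

theorem hasSum_coeff_qPoch_mul (m l n : ℕ) {f : ℤ⟦X⟧} {a : ℂ}
    (h : HasSum (fun k => ((PowerSeries.coeff k f : ℤ) : ℂ) * q ^ k) a) :
    HasSum (fun k => ((PowerSeries.coeff k (qPoch (X ^ m) (X ^ l) n * f) : ℤ) : ℂ) * q ^ k)
      (qPoch (q ^ m) (q ^ l) n * a) := by
  induction n with
  | zero => simpa [qPoch_zero] using h
  | succ n ih =>
    convert! hasSum_coeff_one_sub_X_pow_mul (m + l * n) ih using 1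
    · ext1 k
      rw [qPoch_succ, pow_add, pow_mul]
      congr 3
      ring
    · rw [qPoch_succ]
      ring

theorem hasSum_coeff_X_pow (q : ℂ) (e : ℕ) :
    HasSum (fun k => ((PowerSeries.coeff k (X ^ e : ℤ⟦X⟧) : ℤ) : ℂ) * q ^ k) (q ^ e) := by
  convert! hasSum_ite_eq e (q ^ e) using 1
  ext1 k
  rw [PowerSeries.coeff_X_pow]
  split_ifs with h <;> simp [h]

theorem norm_coeff_mul_pow_le {z : ℤ} {k b : ℕ} (h0 : 0 ≤ z) (h1 : z ≤ b) :
    ‖(z : ℂ) * q ^ k‖ ≤ (b : ℝ) * ‖q‖ ^ k := by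
  rw [norm_mul, norm_pow, Complex.norm_intCast, abs_of_nonneg (Int.cast_nonneg h0)]
  exact mul_le_mul_of_nonneg_right (mod_cast h1) (by positivity)

theorem summable_coeff_of_le_s (hq : ‖q‖ < 1) {f : ℤ⟦X⟧} (h0 : ∀ k, 0 ≤ PowerSeries.coeff k f)
    (h1 : ∀ k, PowerSeries.coeff k f ≤ s k) :
    Summable fun k => ((PowerSeries.coeff k f : ℤ) : ℂ) * q ^ k :=
  (summable_s_mul_pow (norm_nonneg q) hq).of_norm_bounded fun k =>
    norm_coeff_mul_pow_le (h0 k) (h1 k)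

/-- Domination by s gives convergence to some value; multiplying by the denominator turns the series
into a monomial, which identifies that value. -/
theorem hasSum_coeff_formalTerm_mul_pow (hq : ‖q‖ < 1) (n : ℕ × ℕ × ℕ) :
    HasSum (fun k => ((PowerSeries.coeff k (formalTerm n) : ℤ) : ℂ) * q ^ k) (complexTerm q n) := by
  have h := (summable_coeff_of_le_s hq (coeff_formalTerm_nonneg n) (coeff_formalTerm_le n)).hasSum
  have h1 := hasSum_coeff_qPoch_mul 1 1 n.1 (hasSum_coeff_qPoch_mul 6 6 n.2.1
    (hasSum_coeff_qPoch_mul 6 6 n.2.2 h))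
  rw [← den_X_eq, den_mul_formalTerm] at h1
  have h2 := (hasSum_coeff_X_pow q _).unique h1
  convert! h using 1
  rw [complexTerm, div_eq_iff (den_ne_zero hq _ _ _), h2, den, pow_one]
  ring

theorem tendsto_qPoch (hq : ‖q‖ < 1) (m : ℕ) {l : ℕ} (hl : l ≠ 0) :
    Tendsto (qPoch (q ^ m) (q ^ l)) atTop (𝓝 (qPochInf (q ^ m) (q ^ l))) := by
  have hl1 : ‖q ^ l‖ < 1 := by
    rw [norm_pow]
    exact pow_lt_one₀ (norm_nonneg q) hq hl
  have hs : Summable fun j => ‖-(q ^ m * (q ^ l) ^ j)‖ := by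
    simp only [norm_neg, norm_mul, norm_pow _ _]
    refine Summable.mul_left _ ?_
    simpa only [norm_pow] using summable_geometric_of_lt_one (norm_nonneg (q ^ l)) hl1
  have h := (multipliable_one_add_of_summable hs).hasProd.tendsto_prod_nat
  simp only [← sub_eq_add_neg] at h
  exact tendsto_nhds_limUnder ⟨_, h⟩

theorem tsum_s_mul_product (hq : ‖q‖ < 1) :
    (∑' k, (s k : ℂ) * q ^ k) * (qPochInf q (q ^ 6) * qPochInf (q ^ 5) (q ^ 6)) = 1 := by
  have h1 : Tendsto (fun n => ∑' k, ((PowerSeries.coeff k (productInv n) : ℤ) : ℂ) * q ^ k) atTop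
      (𝓝 (∑' k, (s k : ℂ) * q ^ k)) := by
    refine tendsto_tsum_of_dominated_convergence (summable_s_mul_pow (norm_nonneg q) hq)
      (fun k => ?_) (Eventually.of_forall fun n k =>
        norm_coeff_mul_pow_le (coeff_productInv_nonneg n k) (coeff_productInv_le n k))
    have h := (continuous_of_discreteTopology (f := fun z : ℤ => (z : ℂ))).continuousAt.tendsto.comp
      (tendsto_coeff_productInv k)
    simpa using h.mul_const (q ^ k)
  have h2 := tendsto_qPoch hq 1 (l := 6) (by norm_num)
  rw [pow_one] at h2
  refine tendsto_nhds_unique (h1.mul (h2.mul (tendsto_qPoch hq 5 (by norm_num))))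
    (tendsto_const_nhds.congr fun n => ?_)
  have h3 := (summable_coeff_of_le_s hq (coeff_productInv_nonneg n) (coeff_productInv_le n)).hasSum
  have h4 := hasSum_coeff_qPoch_mul 1 6 n (hasSum_coeff_qPoch_mul 5 6 n h3)
  -- The constant 1 is written as X^0 so that `hasSum_coeff_X_pow` evaluates it.
  rw [← mul_assoc, pow_one, pow_one, ← productDen, productDen_mul_productInv, ← pow_zero X] at h4
  rw [← pow_zero q, (hasSum_coeff_X_pow q 0).unique h4]
  ring

theorem hasSum_complexTerm (hq : ‖q‖ < 1) :
    HasSum (complexTerm q) (∑' k, (s k : ℂ) * q ^ k) := by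
  have hk : ∀ (r : ℝ) k, HasSum (fun n => ((PowerSeries.coeff k (formalTerm n) : ℤ) : ℝ) * r ^ k)
      ((s k : ℝ) * r ^ k) := fun r k => by
    have h := (hasSum_coeff_formalTerm k).map (Int.castAddHom ℝ) continuous_of_discreteTopology
    simpa [Function.comp_def] using h.mul_right (r ^ k)
  have hkc : ∀ k, HasSum (fun n => ((PowerSeries.coeff k (formalTerm n) : ℤ) : ℂ) * q ^ k)
      ((s k : ℂ) * q ^ k) := fun k => by
    have h := (hasSum_coeff_formalTerm k).map (Int.castAddHom ℂ) continuous_of_discreteTopology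
    simpa [Function.comp_def] using h.mul_right (q ^ k)
  -- Absolute summability over degree and index jointly; summing over the index first leaves ∑
  -- s(k)‖q‖^k. It justifies exchanging the two summations.
  have hs : Summable fun p : ℕ × ℕ × ℕ × ℕ =>
      ((PowerSeries.coeff p.1 (formalTerm p.2) : ℤ) : ℝ) * ‖q‖ ^ p.1 := by
    rw [summable_prod_of_nonneg fun p => mul_nonneg
      (Int.cast_nonneg (coeff_formalTerm_nonneg p.2 p.1)) (by positivity)]
    refine ⟨fun k => (hk _ k).summable, ?_⟩
    simpa only [fun k => (hk ‖q‖ k).tsum_eq] using summable_s_mul_pow (norm_nonneg q) hq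
  have hc : Summable fun p : ℕ × ℕ × ℕ × ℕ =>
      ((PowerSeries.coeff p.1 (formalTerm p.2) : ℤ) : ℂ) * q ^ p.1 :=
    hs.of_norm_bounded fun p => by
      rw [norm_mul, norm_pow, Complex.norm_intCast,
        abs_of_nonneg (Int.cast_nonneg (coeff_formalTerm_nonneg p.2 p.1))]
  have h1 := hc.hasSum.prod_fiberwise hkc
  have h2 := ((Equiv.prodComm _ _).hasSum_iff.mpr hc.hasSum).prod_fiberwise
    fun n => hasSum_coeff_formalTerm_mul_pow hq n
  rwa [← h1.tsum_eq] at h2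

end Evaluation

end SchurSeries

theorem mainTheorem2 :
    -- the infinite products exist as formal power series and are invertible
    (Tendsto (qPoch (PowerSeries.X : ℤ⟦X⟧) (PowerSeries.X ^ 6)) atTop
        (𝓝 (qPochInf PowerSeries.X (PowerSeries.X ^ 6))) ∧
      Tendsto (qPoch (PowerSeries.X ^ 5 : ℤ⟦X⟧) (PowerSeries.X ^ 6)) atTop
        (𝓝 (qPochInf (PowerSeries.X ^ 5) (PowerSeries.X ^ 6))) ∧
      IsUnit (qPochInf (PowerSeries.X : ℤ⟦X⟧) (PowerSeries.X ^ 6) *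
        qPochInf (PowerSeries.X ^ 5) (PowerSeries.X ^ 6))) ∧
    -- the identity of formal power series
    HasSum formalTerm
      (Ring.inverse (qPochInf (PowerSeries.X : ℤ⟦X⟧) (PowerSeries.X ^ 6) *
        qPochInf (PowerSeries.X ^ 5) (PowerSeries.X ^ 6))) ∧
    -- the series is the series side of Schur's identity
    HasSum formalTerm (PowerSeries.mk fun n => (s n : ℤ)) ∧
    -- the series is positive, term by term
    (∀ (n : ℕ × ℕ × ℕ) (k : ℕ), 0 ≤ PowerSeries.coeff k (formalTerm n)) ∧
    -- the identity for complex numbers in the open unit disc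
    (∀ q : ℂ, ‖q‖ < 1 →
      Tendsto (qPoch q (q ^ 6)) atTop (𝓝 (qPochInf q (q ^ 6))) ∧
      Tendsto (qPoch (q ^ 5) (q ^ 6)) atTop (𝓝 (qPochInf (q ^ 5) (q ^ 6))) ∧
      qPochInf q (q ^ 6) * qPochInf (q ^ 5) (q ^ 6) ≠ 0 ∧
      HasSum (complexTerm q) (1 / (qPochInf q (q ^ 6) * qPochInf (q ^ 5) (q ^ 6)))) := by
  have hX := tendsto_qPoch_X_pow 1 (l := 6) (by norm_num)
  rw [pow_one] at hX
  have hprod := weightedSum_mul_product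
  have hunit := IsUnit.of_mul_eq_one_right _ hprod
  refine ⟨⟨hX, tendsto_qPoch_X_pow 5 (by norm_num), hunit⟩, ?_, ?_, coeff_formalTerm_nonneg,
    fun q hq => ?_⟩
  · rw [← mul_ringInverse_of_mul_eq hunit isUnit_one ((mul_comm _ _).trans hprod),
      Ring.inverse_one, mul_one]
    exact hasSum_formalTerm
  · convert hasSum_formalTerm using 1
    ext k
    rw [PowerSeries.coeff_mk, coeff_weightedSum_zero]
  · have hq1 := tendsto_qPoch hq 1 (l := 6) (by norm_num)
    rw [pow_one] at hq1
    have h := tsum_s_mul_product hq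
    refine ⟨hq1, tendsto_qPoch hq 5 (by norm_num), right_ne_zero_of_mul_eq_one h, ?_⟩
    rw [← eq_one_div_of_mul_eq_one_left h]
    exact hasSum_complexTerm hq
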